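/- Let $p$ be a prime, let $q$ be a power of $p$, let $m_1\mid m$ be positive integers, and regard $\mathbb F_q\subseteq\mathbb F_{q^{m_1}}\subseteq\mathbb F_{q^m}$. Let $\omega$ be a primitive element of $\mathbb F_{q^m}$ (a generator of $\mathbb F_{q^m}^*$), and let $h,n\ge 1$ be integers with $h\mid\frac{q^m-1}{q-1}$, $\frac{q^m-1}{h(q-1)}\mid n$ and $n\le\frac{q^m-1}{h}$. Put $D=\{1,\omega^h,\ldots,\omega^{(n-1)h}\}$ (a set of $n$ distinct elements) and $K=\mathbb F_{q^{m_1}}\times D$. For $a\in\mathbb F_{q^{m_1}}$ and $b\in\mathbb F_{q^m}$ let $$c(a,b)=\bigl(\mathrm{Tr}^{m_1}_1(ax)+\mathrm{Tr}^{m}_1(by)\ \big|\ \mathrm{Tr}^{m_1}_1(ax)+\mathrm{Tr}^{m}_1((a+b)y)\bigr)_{(x,y)\in K}\in\mathbb F_q^{2|K|},$$ where $\mathrm{Tr}^{m_1}_1$ and $\mathrm{Tr}^m_1$ are the traces from $\mathbb F_{q^{m_1}}$ and $\mathbb F_{q^m}$ to $\mathbb F_q$, and let $C_K=\{c(a,b):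 a\in\mathbb F_{q^{m_1}},\ b\in\mathbb F_{q^m}\}$, a linear code over $\mathbb F_q$. Assume that $2\le h<q^{m/2}+1$ and $q^m=p^{2j\gamma}$ with a positive integer $\gamma$, where $j$ is the smallest positive integer with $h\mid p^j+1$. Then $C_K$ is a $[2nq^{m_1},\,m+m_1,\,d]$ code over $\mathbb F_q$ (length, dimension, minimum Hamming distance) with $$d=\begin{cases}\dfrac{2nq^{m/2+m_1-1}(q-1)}{q^m-1}\,(q^{m/2}-1)&\text{if }\gamma\text{ is even},\\[2ex]\dfrac{2nq^{m/2+m_1-1}(q-1)}{q^m-1}\,(q^{m/2}-h+1)&\text{if }\gamma\text{ is odd},\end{cases}$$ it is a three-weight code (its nonzero codewords have exactly three different Hamming weights), and its weight distribution is as follows. The four weights listed are distinct nonnegative integers, and no codeword has any other weight. $$\begin{array}{ll}\text{Weight}&\text{Number of codewords}\\ 0&1\\ 2nq^{m_1-1}(q-1)&q^{m_1+m}-q^m\\ \frac{2nq^{m/2+m_1-1}(q-1)}{q^m-1}\bigl(q^{m/2}+(-1)^{\gamma}(h-1)\bigr)&\frac{q^m-1}{h}\\ \frac{2nq^{m/2+m_1-1}(q-1)}{q^m-1}\bigl(q^{m/2}+(-1)^{\gamma+1}\bigr)&\frac{(q^m-1)(h-1)}{h}\end{array}$$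 -/

import Mathlib

/-- A linear code `C ⊆ F^ι` is an `[N, k, d]` code: it has length `N`, dimension `k` over `F`, and
minimum Hamming distance `d` (attained between two distinct codewords). -/
def IsLinearCodeWithParams {F ι : Type*} [Field F] [DecidableEq F] [Fintype ι]
    (C : Submodule F (ι → F)) (N k d : ℕ) : Prop :=
  Fintype.card ι = N ∧ Module.finrank F C = k ∧
    IsLeast {t : ℕ | ∃ x ∈ C, ∃ y ∈ C, x ≠ y ∧ hammingDist x y = t} d

/-- The number `A_i` of codewords of Hamming weight `i` in `C`. -/
noncomputable def weightCount {F ι : Type*} [Field F] [DecidableEq F] [Fintype ι]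
    (C : Submodule F (ι → F)) (i : ℕ) : ℕ :=
  {c : ι → F | c ∈ C ∧ hammingNorm c = i}.ncard

/-- `C` is a `t`-weight code: exactly `t` of the numbers `A_1, …, A_N` are nonzero, where `N` is the
length of `C`. -/
def IsWeightCode {F ι : Type*} [Field F] [DecidableEq F] [Fintype ι]
    (C : Submodule F (ι → F)) (t : ℕ) : Prop :=
  ((Finset.Icc 1 (Fintype.card ι)).filter fun i => weightCount C i ≠ 0).card = t

/-- The set `D = {1, ω^h, …, ω^{(n-1)h}}` of nonzero elements of `L`. -/
def definingSetD {L : Type*} [Field L] [DecidableEq L] (ω : Lˣ) (h n : ℕ) : Finset L :=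
  (Finset.range n).image fun i => ((ω ^ (h * i) : Lˣ) : L)

/-- The set `K = E × D`. -/
def definingSetK (E : Type*) {L : Type*} [Fintype E] [Field L] [DecidableEq L]
    (ω : Lˣ) (h n : ℕ) : Finset (E × L) :=
  Finset.univ ×ˢ definingSetD ω h n

section Code

variable (F : Type*) {E L : Type*} [Field F] [Field E] [Field L]
  [Algebra F E] [Algebra F L] [Algebra E L]

/-- The word
`c(a, b) = (Tr_{E/F}(ax) + Tr_{L/F}(by) | Tr_{E/F}(ax) + Tr_{L/F}((a + b)y))_{(x, y) ∈ K}`;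
the two halves of the coordinates are the two summands of `K ⊕ K`. -/
noncomputable def codewordK (K : Finset (E × L)) (a : E) (b : L) : ↥K ⊕ ↥K → F :=
  Sum.elim
    (fun z => Algebra.trace F E (a * z.1.1) + Algebra.trace F L (b * z.1.2))
    (fun z => Algebra.trace F E (a * z.1.1) + Algebra.trace F L ((algebraMap E L a + b) * z.1.2))

/-- The linear code `C_K = {c(a, b) : a ∈ E, b ∈ L}` over `F`. -/
noncomputable def codeK [IsScalarTower F E L] (K : Finset (E × L)) :
    Submodule F (↥K ⊕ ↥K → F) where
  carrier := {c | ∃ (a : E) (b : L), c = codewordK F K a b}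
  zero_mem' := ⟨0, 0, by ext (z | z) <;> simp [codewordK]⟩
  add_mem' := by
    rintro _ _ ⟨a, b, rfl⟩ ⟨a', b', rfl⟩
    refine ⟨a + a', b + b', ?_⟩
    ext (z | z) <;> simp only [codewordK, Pi.add_apply, Sum.elim_inl, Sum.elim_inr, add_mul,
      map_add] <;> ring
  smul_mem' := by
    rintro r _ ⟨a, b, rfl⟩
    refine ⟨r • a, r • b, ?_⟩
    have key : algebraMap E L (r • a) = r • algebraMap E L a := by
      rw [Algebra.algebraMap_eq_smul_one, Algebra.algebraMap_eq_smul_one, smul_assoc]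
    ext (z | z) <;> simp only [codewordK, Pi.smul_apply, Sum.elim_inl, Sum.elim_inr, key,
      ← smul_add, smul_mul_assoc, map_smul]

end Code

open Finset

/-! Write q = |F| and L for the field of order q^m. If a ≠ 0, then x ↦ Tr(ax) takes every value of F
equally often, whatever constant is added, so all these codewords have one common weight. If a = 0,
the two halves of the word coincide and its weight is 2q^{m₁} times the number of i < n with
Tr(bω^{hi}) ≠ 0. By orthogonality of characters that number is an affine function of the power sum
S_h(b) = ∑ ψ(bx^h), where ψ = χ ∘ Tr (`traceCount_mul_eq`).

The semiprimitive condition h ∣ Q + 1, with Q = p^j and |L| = Q^{2γ}, makes S_h computable without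
Gauss sums. For exponent Q + 1, the product S(b)S(-b) is |L| times the number of zeros of bz + b^Q
z^{Q²} (`IsFrobeniusChar.powerSum_mul_powerSum_neg`), and there are 1 or Q² of them
(`card_kernel_eq`). Since -1 is a (Q+1)-th power, the product is S(b)², and the congruence S(b) ≡ 1
mod Q + 1 fixes the sign (`eq_neg_one_pow_mul_of_sq_eq`). Averaging over cosets passes from Q + 1 to
its divisor h (`IsFrobeniusChar.powerSum_eq`).

Hence S_h(ω^e) takes one value on a single class of e modulo h and another elsewhere, which gives
the remaining two weights and their frequencies. The bound on h keeps both positive, so (a, b) ↦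
c(a, b) is injective and the dimension follows. -/

/-! ### Sums and counts over ranges of exponents -/

theorem sum_range_mul_of_periodic {M : Type*} [AddCommMonoid M] {f : ℕ → M} {N : ℕ}
    (hf : Function.Periodic f N) (t : ℕ) :
    ∑ i ∈ range (t * N), f i = t • ∑ i ∈ range N, f i := by
  induction t with
  | zero => simp
  | succ t ih =>
    rw [Nat.succ_mul, sum_range_add, ih, succ_nsmul]
    congr 1
    refine sum_congr rfl fun i _ => ?_
    rw [add_comm, ← smul_eq_mul]
    exact hf.nsmul t i

theorem sum_range_mul_eq_sum_sum {M : Type*} [AddCommMonoid M] (f : ℕ → M) (k n : ℕ) :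
    ∑ i ∈ range (n * k), f i = ∑ s ∈ range k, ∑ e ∈ range n, f (s + k * e) := by
  induction n with
  | zero => simp
  | succ n ih =>
    simp only [Nat.succ_mul, sum_range_add, sum_range_succ, sum_add_distrib, ih]
    congr 1
    exact sum_congr rfl fun i _ => by rw [add_comm, mul_comm]

theorem sum_range_two_mul_eq_zero_of_antiperiodic {M : Type*} [AddCommGroup M] {f : ℕ → M} {j : ℕ}
    (hf : ∀ i, f (i + j) = -f i) (t : ℕ) : ∑ i ∈ range (t * (2 * j)), f i = 0 := by
  rw [sum_range_mul_of_periodic (fun i => by rw [two_mul, ← add_assoc, hf, hf, neg_neg]),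
    two_mul, sum_range_add]
  have : ∀ i, f (j + i) = -f i := fun i => by rw [add_comm, hf]
  simp [this]

theorem card_filter_range_dvd {h N : ℕ} (hh : 0 < h) (hN : h ∣ N) (a : ℤ) :
    ((range N).filter fun i : ℕ => (h : ℤ) ∣ (i : ℤ) - a).card = N / h := by
  have h1 := Nat.count_modEq_card N hh (a % h).toNat
  have h0 : (0 : ℤ) ≤ a % h := Int.emod_nonneg _ (by omega)
  rw [Nat.count_eq_card_filter_range, Nat.mod_eq_zero_of_dvd hN] at h1
  simp only [not_lt_zero, if_false, add_zero] at h1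
  rw [← h1]
  congr 1
  refine filter_congr fun i _ => ?_
  rw [← Int.natCast_modEq_iff, Int.toNat_of_nonneg h0]
  constructor
  · intro hd
    exact ((Int.modEq_iff_dvd.mpr hd).symm).trans (Int.mod_modEq a h).symm
  · intro hd
    exact Int.modEq_iff_dvd.mp ((hd.trans (Int.mod_modEq a h)).symm)

/-! ### The cyclic group of units -/

section Generator

variable {L : Type*} [Field L] [Fintype L] {ω : Lˣ}

theorem orderOf_generator (hω : ∀ x : Lˣ, x ∈ Subgroup.zpowers ω) :
    orderOf ω = Fintype.card L - 1 := by
  classical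
  rw [orderOf_eq_card_of_forall_mem_zpowers hω, Nat.card_eq_fintype_card, Fintype.card_units]

theorem exists_pow_eq (hω : ∀ x : Lˣ, x ∈ Subgroup.zpowers ω) (x : Lˣ) : ∃ k : ℕ, ω ^ k = x := by
  have := hω x
  rwa [← mem_powers_iff_mem_zpowers] at this

theorem exists_pow_mul_eq_of_pow_eq_one (hω : ∀ x : Lˣ, x ∈ Subgroup.zpowers ω) {d e : ℕ}
    (hde : e * d = Fintype.card L - 1) {x : Lˣ} (hx : x ^ d = 1) : ∃ k : ℕ, ω ^ (e * k) = x := by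
  obtain ⟨k, rfl⟩ := exists_pow_eq hω x
  have hd : 0 < d := Nat.pos_of_ne_zero fun h0 => by
    have := Fintype.one_lt_card (α := L)
    subst h0
    omega
  rw [← pow_mul, ← orderOf_dvd_iff_pow_eq_one, orderOf_generator hω, ← hde] at hx
  obtain ⟨l, hl⟩ := Nat.dvd_of_mul_dvd_mul_right hd hx
  exact ⟨l, by rw [hl]⟩

theorem generator_pow_card_sub_one (ω : Lˣ) : ω ^ (Fintype.card L - 1) = 1 := by
  classical
  rw [← Fintype.card_units]
  exact pow_card_eq_one

theorem sum_eq_zero_add_sum_range {M : Type*} [AddCommMonoid M]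
    (hω : ∀ x : Lˣ, x ∈ Subgroup.zpowers ω) (g : L → M) :
    ∑ x, g x = g 0 + ∑ e ∈ range (Fintype.card L - 1), g ((ω ^ e : Lˣ) : L) := by
  classical
  rw [← Finset.add_sum_erase univ g (mem_univ 0)]
  congr 1
  symm
  refine sum_bij (fun e _ => ((ω ^ e : Lˣ) : L)) (by simp) ?_ ?_ (by simp)
  · intro a ha b hb hab
    rw [mem_range, ← orderOf_generator hω] at ha hb
    exact pow_injOn_Iio_orderOf ha hb (Units.ext hab)
  · intro b hb
    obtain ⟨k, hk⟩ := exists_pow_eq hω (Units.mk0 b (by simpa using hb))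
    have hpos : 0 < Fintype.card L - 1 := by
      have := Fintype.one_lt_card (α := L)
      omega
    refine ⟨k % (Fintype.card L - 1), mem_range.2 (Nat.mod_lt _ hpos), ?_⟩
    rw [← orderOf_generator hω, pow_mod_orderOf, hk]
    rfl

theorem card_pow_eq_one_eq (hω : ∀ x : Lˣ, x ∈ Subgroup.zpowers ω) {d : ℕ} (hd0 : 0 < d)
    (hd : d ∣ Fintype.card L - 1) : Nat.card {x : L // x ^ d = 1} = d := by
  classical
  obtain ⟨e, he⟩ := hd
  have hprim : IsPrimitiveRoot ω (Fintype.card L - 1) := orderOf_generator hω ▸ .orderOf ω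
  have h2 := (hprim.pow (by have := Fintype.one_lt_card (α := L); omega)
    (he.trans (mul_comm _ _))).map_of_injective (f := Units.coeHom L) Units.val_injective
  conv_rhs => rw [← h2.card_nthRootsFinset]
  rw [Nat.card_eq_fintype_card, Fintype.card_subtype]
  congr 1
  ext x
  simp [Polynomial.mem_nthRootsFinset hd0]

end Generator

/-! ### Power sums of Frobenius-invariant characters -/

section Character

/-- A primitive additive character of a field on which `x ↦ x ^ Q` is additive, invariant under
that map and trivial on the elements `u` with `u ^ Q = -u`. -/
structure IsFrobeniusChar {L : Type*} [Field L] (ψ : AddChar L ℂ) (Q : ℕ) : Prop where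
  isPrimitive : ψ.IsPrimitive
  add_pow : ∀ x y : L, (x + y) ^ Q = x ^ Q + y ^ Q
  apply_pow : ∀ x, ψ (x ^ Q) = ψ x
  apply_eq_one : ∀ u, u ^ Q = -u → ψ u = 1

/-- The sum `∑ x, ψ (b * x ^ d)`. -/
noncomputable def powerSum {L : Type*} [Field L] [Fintype L] (ψ : AddChar L ℂ) (d : ℕ) (b : L) : ℂ :=
  ∑ x, ψ (b * x ^ d)

variable {L : Type*} [Field L] [Fintype L] {ψ : AddChar L ℂ} {ω : Lˣ}

theorem powerSum_mul_pow (d : ℕ) (b : L) {v : L} (hv : v ≠ 0) :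
    powerSum ψ d (b * v ^ d) = powerSum ψ d b :=
  Fintype.sum_equiv (Equiv.mulLeft₀ v hv) _ _ fun x => by
    simp [mul_pow, mul_assoc]

theorem powerSum_eq_one_add (hω : ∀ x : Lˣ, x ∈ Subgroup.zpowers ω) {d : ℕ} (hd : d ≠ 0) (b : L) :
    powerSum ψ d b =
      1 + ∑ e ∈ range (Fintype.card L - 1), ψ (b * ((ω ^ (d * e) : Lˣ) : L)) := by
  rw [powerSum, sum_eq_zero_add_sum_range hω]
  simp [hd, pow_mul, mul_comm d]

/-- On the units, x ↦ x^d is d-to-one onto its image because d ∣ |L| - 1. The shape 1 + d ·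
(algebraic integer) later determines a sign. -/
theorem powerSum_eq_one_add_mul (hω : ∀ x : Lˣ, x ∈ Subgroup.zpowers ω) {d M : ℕ} (hd : d ≠ 0)
    (hM : d * M = Fintype.card L - 1) (b : L) :
    powerSum ψ d b = 1 + d * ∑ e ∈ range M, ψ (b * ((ω ^ (d * e) : Lˣ) : L)) := by
  rw [powerSum_eq_one_add hω hd, ← hM, sum_range_mul_of_periodic, nsmul_eq_mul]
  intro e
  dsimp only
  rw [mul_add, hM, pow_add, generator_pow_card_sub_one, mul_one]

theorem isIntegral_addChar_apply (x : L) : IsIntegral ℤ (ψ x) := by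
  refine IsIntegral.of_pow (n := ringChar L) (Nat.pos_of_ne_zero (CharP.ringChar_ne_zero_of_finite L)) ?_
  rw [← AddChar.map_nsmul_eq_pow, nsmul_eq_mul, CharP.cast_eq_zero, zero_mul, AddChar.map_zero_eq_one]
  exact isIntegral_one

theorem exists_int_eq_of_isIntegral {z : ℂ} (hz : IsIntegral ℤ z) {d a : ℤ} (hd : d ≠ 0)
    (h : (d : ℂ) * z = a) : d ∣ a := by
  have h1 : z = algebraMap ℚ ℂ ((a : ℚ) / d) := by
    have : (d : ℂ) ≠ 0 := by exact_mod_cast hd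
    simp
    field_simp
    rw [← h]; ring
  rw [h1, isIntegral_algebraMap_iff (algebraMap ℚ ℂ).injective] at hz
  obtain ⟨k, hk⟩ := IsIntegrallyClosed.isIntegral_iff.1 hz
  refine ⟨k, ?_⟩
  have : (d : ℚ) ≠ 0 := by exact_mod_cast hd
  have hk' : (k : ℚ) = a / d := hk
  field_simp at hk'
  have : k * d = a := by exact_mod_cast hk'
  linarith

variable {Q : ℕ}

theorem IsFrobeniusChar.ne_zero {L : Type*} [Field L] {ψ : AddChar L ℂ} {Q : ℕ}
    (hψ : IsFrobeniusChar ψ Q) : Q ≠ 0 := by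
  rintro rfl
  have := hψ.add_pow 0 0
  simp at this

theorem IsFrobeniusChar.neg_pow {L : Type*} [Field L] {ψ : AddChar L ℂ} {Q : ℕ}
    (hψ : IsFrobeniusChar ψ Q) (x : L) : (-x) ^ Q = -x ^ Q := by
  have := hψ.add_pow x (-x)
  rw [add_neg_cancel, zero_pow hψ.ne_zero] at this
  exact (neg_eq_of_add_eq_zero_right this.symm).symm

theorem IsFrobeniusChar.bijective_pow (hψ : IsFrobeniusChar ψ Q) :
    Function.Bijective fun x : L => x ^ Q := by
  refine Finite.injective_iff_bijective.1 fun x y hxy => ?_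
  have := hψ.add_pow x (-y)
  rw [hψ.neg_pow, hxy, add_neg_cancel] at this
  have := pow_eq_zero_iff hψ.ne_zero |>.1 this
  linear_combination this

-- Substitute x = y + z in the first factor. The terms in y alone cancel, and the sum over y is then
-- an orthogonality relation that leaves only the zeros z of bz + b^Q z^{Q²}. At such z the element
-- u = bz^{Q+1} satisfies u^Q = -u, so it contributes ψ(u) = 1.
open Classical in
theorem IsFrobeniusChar.powerSum_mul_powerSum_neg (hψ : IsFrobeniusChar ψ Q) (b : L) :
    powerSum ψ (Q + 1) b * powerSum ψ (Q + 1) (-b) =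
      Fintype.card L * Nat.card {z : L // b * z + b ^ Q * z ^ (Q ^ 2) = 0} := by
  have h1 : ∀ y z : L, ψ (b * (y + z) ^ (Q + 1)) * ψ (-b * y ^ (Q + 1)) =
      ψ (b * z ^ (Q + 1)) * ψ (y ^ Q * (b * z + b ^ Q * z ^ (Q ^ 2))) := by
    intro y z
    -- Frobenius invariance turns the term linear in y into one linear in y^Q, so that both mixed
    -- terms share the factor y^Q.
    have : ψ (b * y * z ^ Q) = ψ (b ^ Q * y ^ Q * z ^ (Q ^ 2)) := by
      rw [← hψ.apply_pow]
      congr 1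
      ring
    rw [pow_succ, hψ.add_pow, show b * ((y ^ Q + z ^ Q) * (y + z)) =
      b * y ^ (Q + 1) + (b * z ^ (Q + 1) + (b * y * z ^ Q + b * y ^ Q * z)) by ring,
      AddChar.map_add_eq_mul, AddChar.map_add_eq_mul, AddChar.map_add_eq_mul, this, mul_right_comm,
      ← AddChar.map_add_eq_mul, ← AddChar.map_add_eq_mul,
      show b * y ^ (Q + 1) + -b * y ^ (Q + 1) = 0 by ring, AddChar.map_zero_eq_one, one_mul]
    congr 2
    ring
  have h2 : ∀ z : L, b * z + b ^ Q * z ^ (Q ^ 2) = 0 → ψ (b * z ^ (Q + 1)) = 1 := by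
    intro z hz
    refine hψ.apply_eq_one _ ?_
    rw [mul_pow, ← pow_mul]
    linear_combination z ^ Q * hz
  have h3 : ∀ z : L, ∑ y, ψ (y ^ Q * (b * z + b ^ Q * z ^ (Q ^ 2))) =
      if b * z + b ^ Q * z ^ (Q ^ 2) = 0 then (Fintype.card L : ℂ) else 0 := by
    intro z
    rw [hψ.bijective_pow.sum_comp fun y => ψ (y * (b * z + b ^ Q * z ^ (Q ^ 2))),
      AddChar.sum_mulShift _ hψ.isPrimitive]
    push_cast
    rfl
  calc powerSum ψ (Q + 1) b * powerSum ψ (Q + 1) (-b)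
      = ∑ y, ∑ z, ψ (b * (y + z) ^ (Q + 1)) * ψ (-b * y ^ (Q + 1)) := by
        rw [powerSum, powerSum, mul_comm, sum_mul]
        refine sum_congr rfl fun y _ => ?_
        rw [mul_comm, sum_mul, ← Equiv.sum_comp (Equiv.addLeft y)]
        rfl
    _ = ∑ z, ψ (b * z ^ (Q + 1)) * ∑ y, ψ (y ^ Q * (b * z + b ^ Q * z ^ (Q ^ 2))) := by
        rw [sum_comm]
        simp only [h1, mul_sum]
    _ = ∑ z, if b * z + b ^ Q * z ^ (Q ^ 2) = 0 then (Fintype.card L : ℂ) else 0 := by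
        refine sum_congr rfl fun z _ => ?_
        rw [h3]
        split_ifs with hz
        · rw [h2 z hz, one_mul]
        · simp
    _ = _ := by
        rw [← sum_filter, sum_const, nsmul_eq_mul, mul_comm, Nat.card_eq_fintype_card,
          Fintype.card_subtype]

end Character

/-! ### Evaluation of the power sum with exponent Q + 1 -/

section Evaluation

theorem dvd_pow_sub_neg_one_pow (Q n : ℕ) : ((Q + 1 : ℕ) : ℤ) ∣ (Q : ℤ) ^ n - (-1) ^ n := by
  have := sub_dvd_pow_sub_pow (Q : ℤ) (-1) n
  rwa [sub_neg_eq_add] at this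

/-- The square leaves S = ±Q^n. Modulo Q + 1 one has S ≡ 1 and Q^n ≡ (-1)^n, and the wrong sign
would force Q + 1 ≥ 3 to divide 2. -/
theorem eq_neg_one_pow_mul_of_sq_eq {Q n : ℕ} (hQ : 2 ≤ Q) {S η : ℂ} (hη : IsIntegral ℤ η)
    (hS : S = 1 + ((Q + 1 : ℕ) : ℂ) * η) (hsq : S ^ 2 = (Q : ℂ) ^ (2 * n)) :
    S = (-1) ^ n * (Q : ℂ) ^ n := by
  have hn := dvd_pow_sub_neg_one_pow Q n
  have key : ∀ s : ℤ, S = s * (Q : ℂ) ^ n → ((Q + 1 : ℕ) : ℤ) ∣ s * (Q : ℤ) ^ n - 1 := by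
    intro s hs
    refine exists_int_eq_of_isIntegral hη (by omega) ?_
    push_cast at hS ⊢
    rw [← hs, hS]
    ring
  have hnd : ¬ ((Q + 1 : ℕ) : ℤ) ∣ 2 := fun h => by
    have := Int.le_of_dvd (by norm_num) h
    omega
  have hcase : S = (1 : ℤ) * (Q : ℂ) ^ n ∨ S = (-1 : ℤ) * (Q : ℂ) ^ n := by
    have : S ^ 2 = ((Q : ℂ) ^ n) ^ 2 := by rw [hsq, ← pow_mul, mul_comm]
    rcases sq_eq_sq_iff_eq_or_eq_neg.1 this with h | h
    · left; simpa using h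
    · right; simpa using h
  rcases hcase with h | h <;> rcases neg_one_pow_eq_or ℤ n with hs | hs
  · have h' : ((-1 : ℂ)) ^ n = 1 := by exact_mod_cast congrArg (Int.cast : ℤ → ℂ) hs
    rw [h, h']; simp
  · refine absurd ?_ hnd
    have := dvd_sub hn (key _ h)
    rw [hs] at this
    ring_nf at this
    simpa [add_comm] using this
  · refine absurd ?_ hnd
    have := dvd_add hn (key _ h)
    rw [hs] at this
    ring_nf at this
    simpa [add_comm] using this
  · have h' : ((-1 : ℂ)) ^ n = -1 := by exact_mod_cast congrArg (Int.cast : ℤ → ℂ) hs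
    rw [h, h']; simp

variable {L : Type*} [Field L] [Fintype L] {ψ : AddChar L ℂ} {ω : Lˣ} {Q γ : ℕ}

theorem two_le_of_card_eq (hcard : Fintype.card L = Q ^ (2 * γ)) : 2 ≤ Q := by
  have h1 := Fintype.one_lt_card (α := L)
  rw [hcard] at h1
  rcases Q with _ | _ | Q
  · rcases γ with _ | γ <;> simp [Nat.mul_succ] at h1
  · simp at h1
  · omega

theorem exists_mul_eq_card_sub_one {L : Type*} [Fintype L] {Q γ : ℕ}
    (hcard : Fintype.card L = Q ^ (2 * γ)) :
    ∃ K, (Q + 1) * (Q - 1) * K = Fintype.card L - 1 := by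
  have h := Nat.sub_dvd_pow_sub_pow (Q ^ 2) 1 γ
  rw [one_pow, ← pow_mul, ← hcard] at h
  obtain ⟨K, hK⟩ := h
  refine ⟨K, ?_⟩
  rw [hK, ← Nat.sq_sub_sq, one_pow]

theorem exists_pow_mul_eq_of_pow_sub_one_eq_one (hω : ∀ x : Lˣ, x ∈ Subgroup.zpowers ω)
    (hcard : Fintype.card L = Q ^ (2 * γ)) {x : Lˣ} (hx : x ^ (Q - 1) = 1) :
    ∃ k : ℕ, ω ^ ((Q + 1) * k) = x := by
  obtain ⟨K, hK⟩ := exists_mul_eq_card_sub_one hcard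
  obtain ⟨k, hk⟩ := exists_pow_mul_eq_of_pow_eq_one hω (e := (Q + 1) * K) (d := Q - 1)
    (by rw [← hK]; ring) hx
  exact ⟨K * k, by rw [← hk, mul_assoc]⟩

theorem IsFrobeniusChar.neg_one_pow_eq {L : Type*} [Field L] {ψ : AddChar L ℂ} {Q : ℕ}
    (hψ : IsFrobeniusChar ψ Q) : (-1 : Lˣ) ^ Q = -1 := by
  ext
  simp [hψ.neg_pow 1]

/-- The exponent e₀ marks the exceptional class of b. It exists because (-1)^{Q+1} = 1, in every
characteristic. -/
theorem IsFrobeniusChar.exists_pow_eq_neg_one (hψ : IsFrobeniusChar ψ Q)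
    (hω : ∀ x : Lˣ, x ∈ Subgroup.zpowers ω) (hcard : Fintype.card L = Q ^ (2 * γ)) :
    ∃ e₀ : ℕ, (ω ^ e₀) ^ (Q - 1) = -1 := by
  obtain ⟨K, hK⟩ := exists_mul_eq_card_sub_one hcard
  obtain ⟨k, hk⟩ := exists_pow_mul_eq_of_pow_eq_one hω (e := Q - 1) (d := (Q + 1) * K)
    (x := -1) (by rw [← hK]; ring) (by rw [pow_mul, pow_succ, hψ.neg_one_pow_eq]; simp)
  exact ⟨k, by rw [← hk, mul_comm, pow_mul]⟩

/-- From (-1)^{Q-1} = 1 it follows that -1 is a (Q+1)-th power, which the substitution x ↦ vx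
absorbs. -/
theorem IsFrobeniusChar.powerSum_neg (hψ : IsFrobeniusChar ψ Q)
    (hω : ∀ x : Lˣ, x ∈ Subgroup.zpowers ω) (hcard : Fintype.card L = Q ^ (2 * γ)) (b : L) :
    powerSum ψ (Q + 1) (-b) = powerSum ψ (Q + 1) b := by
  have h1 : (-1 : Lˣ) ^ (Q - 1) = 1 := by
    have := hψ.neg_one_pow_eq
    rw [← Nat.sub_add_cancel (Nat.one_le_iff_ne_zero.2 hψ.ne_zero), pow_succ] at this
    simpa using this
  obtain ⟨k, hk⟩ := exists_pow_mul_eq_of_pow_sub_one_eq_one hω hcard h1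
  rw [← powerSum_mul_pow (Q + 1) b (Units.ne_zero (ω ^ k))]
  congr 1
  rw [← Units.val_pow_eq_pow_val, ← pow_mul, mul_comm k, hk]
  simp

/-- The solutions of x^{Q-1} = -1 form the coset of ω^{e₀} under the (Q-1)-th roots of unity, and
those roots are all (Q+1)-th powers. -/
theorem exists_kernel_iff (hω : ∀ x : Lˣ, x ∈ Subgroup.zpowers ω)
    (hcard : Fintype.card L = Q ^ (2 * γ)) {e₀ : ℕ} (he₀ : (ω ^ e₀) ^ (Q - 1) = -1) (e : ℕ) :
    (∃ z : Lˣ, (ω ^ e * z ^ (Q + 1)) ^ (Q - 1) = -1) ↔ ((Q + 1 : ℕ) : ℤ) ∣ (e : ℤ) - e₀ := by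
  constructor
  · rintro ⟨z, hz⟩
    have h1 : ((ω ^ e * z ^ (Q + 1)) * (ω ^ e₀)⁻¹) ^ (Q - 1) = 1 := by
      rw [mul_pow, hz, inv_pow, he₀]; simp
    obtain ⟨k, hk⟩ := exists_pow_mul_eq_of_pow_sub_one_eq_one hω hcard h1
    obtain ⟨l, rfl⟩ := exists_pow_eq hω z
    have h2 : ω ^ ((e : ℤ) + (Q + 1 : ℕ) * l - e₀ - (Q + 1 : ℕ) * k) = 1 := by
      rw [zpow_sub, mul_inv_eq_one, zpow_sub, zpow_add]
      exact_mod_cast (by rw [hk, ← pow_mul, mul_comm l] :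
        ω ^ e * ω ^ ((Q + 1) * l) * (ω ^ e₀)⁻¹ = ω ^ ((Q + 1) * k))
    rw [← orderOf_dvd_iff_zpow_eq_one, orderOf_generator hω] at h2
    obtain ⟨K, hK⟩ := exists_mul_eq_card_sub_one hcard
    have h3 : ((Q + 1 : ℕ) : ℤ) ∣ ((Fintype.card L - 1 : ℕ) : ℤ) := by
      rw [← hK, mul_assoc]
      exact_mod_cast dvd_mul_right _ _
    have h4 := dvd_sub (dvd_add (h3.trans h2) (dvd_mul_right _ (k : ℤ))) (dvd_mul_right _ (l : ℤ))
    rwa [show (e : ℤ) + (Q + 1 : ℕ) * l - e₀ - (Q + 1 : ℕ) * k + (Q + 1 : ℕ) * k -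
      (Q + 1 : ℕ) * l = e - e₀ by ring] at h4
  · rintro ⟨t, ht⟩
    refine ⟨ω ^ (-t), ?_⟩
    rw [← he₀]
    congr 1
    rw [← zpow_natCast, ← zpow_natCast, ← zpow_natCast, ← zpow_mul, ← zpow_add]
    congr 1
    linear_combination ht

/-- A nonzero z is a zero exactly when (bz^{Q+1})^{Q-1} = -1. Given one such z₀, the others are z₀t
with t^{Q²-1} = 1; there are Q² - 1 of them, and z = 0 is added. -/
theorem card_kernel_eq (hω : ∀ x : Lˣ, x ∈ Subgroup.zpowers ω)
    (hcard : Fintype.card L = Q ^ (2 * γ)) (b : Lˣ) [Decidable (∃ z : Lˣ, (b * z ^ (Q + 1)) ^ (Q - 1) = -1)] :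
    Nat.card {z : L // (b : L) * z + b ^ Q * z ^ (Q ^ 2) = 0} =
      if ∃ z : Lˣ, (b * z ^ (Q + 1)) ^ (Q - 1) = -1 then Q ^ 2 else 1 := by
  have hQ := two_le_of_card_eq hcard
  have hker : ∀ z : Lˣ, (b : L) * z + b ^ Q * z ^ (Q ^ 2) = 0 ↔
      (b * z ^ (Q + 1)) ^ (Q - 1) = -1 := by
    intro z
    obtain ⟨P, rfl⟩ : ∃ P, Q = P + 1 := ⟨Q - 1, by omega⟩
    rw [Units.ext_iff]
    push_cast
    rw [show (b : L) * z + b ^ (P + 1) * z ^ ((P + 1) ^ 2) =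
      (b * z) * ((b * z ^ (P + 1 + 1)) ^ P + 1) by ring, mul_eq_zero, add_eq_zero_iff_eq_neg]
    simp
  change Nat.card ({z : L | (b : L) * z + b ^ Q * z ^ (Q ^ 2) = 0} : Set L) = _
  rw [Nat.card_coe_set_eq]
  split_ifs with h
  · obtain ⟨z₀, hz₀⟩ := h
    have hpow : ∀ t : L, t ^ (Q ^ 2) = t * t ^ (Q ^ 2 - 1) := fun t => by
      rw [← pow_succ', Nat.sub_add_cancel (Nat.one_le_pow _ _ (by omega))]
    have h1 : {z : L | (b : L) * z + b ^ Q * z ^ (Q ^ 2) = 0} =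
        insert 0 ((fun t => (z₀ : L) * t) '' {t : L | t ^ (Q ^ 2 - 1) = 1}) := by
      have hz₁ := (hker z₀).2 hz₀
      ext z
      obtain ⟨t, rfl⟩ : ∃ t, z = z₀ * t := ⟨z₀⁻¹ * z, by simp⟩
      simp only [Set.mem_ofPred_eq, Set.mem_insert_iff, Set.mem_image, mul_right_inj' z₀.ne_zero,
        exists_eq_right, mul_eq_zero, z₀.ne_zero, false_or]
      rw [show (b : L) * (z₀ * t) + b ^ Q * (z₀ * t) ^ (Q ^ 2) =
        (b * z₀) * (t * (1 - t ^ (Q ^ 2 - 1))) by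
          rw [mul_pow, hpow t]; linear_combination t * t ^ (Q ^ 2 - 1) * hz₁]
      simp [sub_eq_zero, eq_comm (a := (1 : L))]
    have hdvd : Q ^ 2 - 1 ∣ Fintype.card L - 1 := by
      have h := Nat.sub_dvd_pow_sub_pow (Q ^ 2) 1 γ
      rwa [one_pow, ← pow_mul, ← hcard] at h
    have h4 : 4 ≤ Q ^ 2 := Nat.pow_le_pow_left hQ 2
    have h2 := card_pow_eq_one_eq hω (by omega) hdvd
    rw [h1, Set.ncard_insert_of_notMem, Set.ncard_image_of_injective _
      (mul_right_injective₀ z₀.ne_zero)]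
    · change Nat.card ({x : L | x ^ (Q ^ 2 - 1) = 1} : Set L) = _ at h2
      rw [Nat.card_coe_set_eq] at h2
      rw [h2]
      omega
    · rintro ⟨t, ht, h0⟩
      have : t = 0 := by simpa using h0
      rw [this, Set.mem_ofPred_eq, zero_pow (by omega)] at ht
      exact zero_ne_one ht
  · rw [Set.ncard_eq_one]
    refine ⟨0, ?_⟩
    ext z
    simp only [Set.mem_ofPred_eq, Set.mem_singleton_iff]
    constructor
    · intro hz
      by_contra h0
      exact h ⟨Units.mk0 z h0, (hker (Units.mk0 z h0)).1 hz⟩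
    · rintro rfl
      simp [show Q ≠ 0 by omega]

open Classical in
theorem IsFrobeniusChar.powerSum_succ_eq (hψ : IsFrobeniusChar ψ Q)
    (hω : ∀ x : Lˣ, x ∈ Subgroup.zpowers ω) (hcard : Fintype.card L = Q ^ (2 * γ))
    {e₀ : ℕ} (he₀ : (ω ^ e₀) ^ (Q - 1) = -1) (e : ℕ) :
    powerSum ψ (Q + 1) ((ω ^ e : Lˣ) : L) =
      (-1) ^ γ * Q ^ γ * (1 - (Q + 1) * if ((Q + 1 : ℕ) : ℤ) ∣ (e : ℤ) - e₀ then 1 else 0) := by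
  obtain ⟨K, hK⟩ := exists_mul_eq_card_sub_one hcard
  have h1 := powerSum_eq_one_add_mul (ψ := ψ) hω (Nat.succ_ne_zero Q)
    (by rw [← hK, mul_assoc]) ((ω ^ e : Lˣ) : L)
  have h2 := hψ.powerSum_mul_powerSum_neg ((ω ^ e : Lˣ) : L)
  have hint : IsIntegral ℤ (∑ i ∈ range ((Q - 1) * K),
      ψ (((ω ^ e : Lˣ) : L) * ((ω ^ ((Q + 1) * i) : Lˣ) : L))) :=
    IsIntegral.sum _ fun i _ => isIntegral_addChar_apply _
  rw [hψ.powerSum_neg hω hcard, ← sq, card_kernel_eq hω hcard, hcard] at h2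
  simp only [exists_kernel_iff hω hcard he₀] at h2
  have hQ := two_le_of_card_eq hcard
  split_ifs at h2 ⊢
  -- The larger kernel multiplies the square by Q², hence γ + 1; then (-1)^{γ+1} Q^{γ+1} = (-1)^γ
  -- Q^γ (1 - (Q + 1)).
  · rw [eq_neg_one_pow_mul_of_sq_eq (n := γ + 1) hQ hint h1 (by rw [h2]; push_cast; ring)]
    ring
  · rw [eq_neg_one_pow_mul_of_sq_eq (n := γ) hQ hint h1 (by rw [h2]; push_cast; ring)]
    ring

end Evaluation

/-! ### Descent from Q + 1 to its divisor h -/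

section PowerSum

variable {L : Type*} [Field L] [Fintype L] {ψ : AddChar L ℂ} {ω : Lˣ} {Q γ : ℕ}

/-- Let e run over k periods of ω^{he} and sort by e modulo k: this splits k copies of the h-th
powers into translates of the hk-th powers. -/
theorem mul_powerSum_eq_sum (hω : ∀ x : Lˣ, x ∈ Subgroup.zpowers ω) {h k : ℕ} (hh : h ≠ 0)
    (hk : k ≠ 0) (b : L) :
    k * powerSum ψ h b =
      ∑ s ∈ range k, powerSum ψ (h * k) (b * ((ω ^ (h * s) : Lˣ) : L)) := by
  simp only [powerSum_eq_one_add hω hh, powerSum_eq_one_add hω (mul_ne_zero hh hk),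
    sum_add_distrib, sum_const, card_range, nsmul_eq_mul, mul_one, mul_add]
  congr 1
  have hper : Function.Periodic (fun e => ψ (b * ((ω ^ (h * e) : Lˣ) : L)))
      (Fintype.card L - 1) := fun e => by
    dsimp only
    rw [mul_add, pow_add, mul_comm h (_ - 1), pow_mul _ (_ - 1), generator_pow_card_sub_one,
      one_pow, mul_one]
  rw [← nsmul_eq_mul, ← sum_range_mul_of_periodic hper, mul_comm k, sum_range_mul_eq_sum_sum]
  refine sum_congr rfl fun s _ => sum_congr rfl fun e _ => ?_
  rw [mul_assoc b, ← Units.val_mul, ← pow_add]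
  congr 5
  ring

open Classical in
theorem sum_range_ite_dvd_add {h k : ℕ} (hh : h ≠ 0) (hk : k ≠ 0) (a : ℤ) :
    (∑ s ∈ range k, if ((h * k : ℕ) : ℤ) ∣ a + h * s then (1 : ℂ) else 0) =
      if (h : ℤ) ∣ a then 1 else 0 := by
  split_ifs with hd
  · obtain ⟨c, rfl⟩ := hd
    have h1 : ∀ s : ℕ, ((h * k : ℕ) : ℤ) ∣ h * c + h * s ↔ (k : ℤ) ∣ (s : ℤ) - (-c) := fun s => by
      push_cast
      rw [← mul_add, mul_dvd_mul_iff_left (by exact_mod_cast hh), sub_neg_eq_add, add_comm]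
    have h2 := card_filter_range_dvd (Nat.pos_of_ne_zero hk) dvd_rfl (-c)
    rw [Nat.div_self (Nat.pos_of_ne_zero hk)] at h2
    simp only [h1]
    rw [← sum_filter, sum_const, nsmul_eq_mul, mul_one]
    exact_mod_cast (by convert h2)
  · refine sum_eq_zero fun s _ => if_neg fun h' => hd ?_
    have : (h : ℤ) ∣ a + h * s := (Int.natCast_dvd_natCast.2 (dvd_mul_right h k)).trans h'
    exact (dvd_add_left (dvd_mul_right _ _)).1 this

-- With Q + 1 = hk, the value is the mean of k sums of exponent Q + 1. At most one of them is
-- exceptional, and one is exactly when e ≡ e₀ mod h, so the correction hk is divided by k.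
open Classical in
theorem IsFrobeniusChar.powerSum_eq (hψ : IsFrobeniusChar ψ Q)
    (hω : ∀ x : Lˣ, x ∈ Subgroup.zpowers ω) (hcard : Fintype.card L = Q ^ (2 * γ))
    {h : ℕ} (hh : h ∣ Q + 1) {e₀ : ℕ} (he₀ : (ω ^ e₀) ^ (Q - 1) = -1) (e : ℕ) :
    powerSum ψ h ((ω ^ e : Lˣ) : L) =
      (-1) ^ γ * Q ^ γ * (1 - h * if (h : ℤ) ∣ (e : ℤ) - e₀ then 1 else 0) := by
  obtain ⟨k, hk⟩ := hh
  have hh0 : h ≠ 0 := by rintro rfl; simp at hk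
  have hk0 : k ≠ 0 := by rintro rfl; simp at hk
  have h1 := mul_powerSum_eq_sum (ψ := ψ) hω hh0 hk0 ((ω ^ e : Lˣ) : L)
  have h2 : ∀ s : ℕ, powerSum ψ (h * k) (((ω ^ e : Lˣ) : L) * ((ω ^ (h * s) : Lˣ) : L)) =
      (-1) ^ γ * Q ^ γ * (1 - h * k * if ((h * k : ℕ) : ℤ) ∣ (e : ℤ) - e₀ + h * s then 1 else 0) := by
    intro s
    rw [← Units.val_mul, ← pow_add, ← hk, hψ.powerSum_succ_eq hω hcard he₀]
    have : ((Q : ℂ) + 1) = h * k := by exact_mod_cast congrArg (Nat.cast : ℕ → ℂ) hk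
    rw [this]
    congr 5
    push_cast
    ring
  simp only [h2] at h1
  rw [← mul_sum, sum_sub_distrib, ← mul_sum, sum_range_ite_dvd_add hh0 hk0] at h1
  have hkc : (k : ℂ) ≠ 0 := by exact_mod_cast hk0
  apply mul_left_cancel₀ hkc
  rw [h1]
  simp only [sum_const, card_range, nsmul_eq_mul, mul_one]
  ring

end PowerSum

/-! ### The character obtained from the trace -/

section Trace

theorem isPrimitive_stdAddChar_comp_trace (p : ℕ) [Fact p.Prime] (K : Type*) [Field K] [Finite K]
    [Algebra (ZMod p) K] :
    ((ZMod.stdAddChar (N := p)).compAddMonoidHom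
      (Algebra.trace (ZMod p) K).toAddMonoidHom).IsPrimitive := by
  refine AddChar.IsPrimitive.of_ne_one fun h1 => ?_
  have : Module.Finite (ZMod p) K := Module.Finite.of_finite
  have : Algebra.IsAlgebraic (ZMod p) K := Algebra.IsAlgebraic.of_finite (ZMod p) K
  have : Algebra.IsSeparable (ZMod p) K := Algebra.IsAlgebraic.isSeparable_of_perfectField
  obtain ⟨x, hx⟩ := Algebra.trace_surjective (ZMod p) K 1
  have h2 := DFunLike.congr_fun h1 x
  rw [AddChar.compAddMonoidHom_apply] at h2
  change ZMod.stdAddChar (Algebra.trace (ZMod p) K x) = 1 at h2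
  rw [hx, ← AddChar.map_zero_eq_one (ZMod.stdAddChar (N := p))] at h2
  exact one_ne_zero (ZMod.injective_stdAddChar h2)

variable (F L : Type*) [Field F] [Field L] [Fintype F] [Fintype L] [Algebra F L]

/-- Take for χ the standard character of the prime field composed with the trace from F. By
transitivity χ ∘ Tr is the absolute trace character of L, which is invariant under x ↦ x^p. -/
theorem exists_isFrobeniusChar {p j γ : ℕ} (hp : p.Prime)
    (hcard : Fintype.card L = p ^ (2 * j * γ)) :
    ∃ χ : AddChar F ℂ, χ.IsPrimitive ∧
      IsFrobeniusChar (χ.compAddMonoidHom (Algebra.trace F L).toAddMonoidHom) (p ^ j) := by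
  have : Fact p.Prime := ⟨hp⟩
  have : CharP L p := by
    obtain ⟨p', hp'⟩ := CharP.exists L
    obtain ⟨n, hn', hn⟩ := FiniteField.card L p'
    have : p' ∣ p ^ (2 * j * γ) := by
      rw [← hcard, hn]
      exact dvd_pow_self _ n.ne_zero
    rwa [(Nat.prime_dvd_prime_iff_eq hn' hp).1 (hn'.dvd_of_dvd_pow this)] at hp'
  have : CharP F p := (algebraMap F L).charP (algebraMap F L).injective p
  let := ZMod.algebra F p
  let := ZMod.algebra L p
  have : IsScalarTower (ZMod p) F L := IsScalarTower.of_algebraMap_eq' (Subsingleton.elim _ _)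
  have htr : ∀ x : L, Algebra.trace (ZMod p) L (x ^ p) = Algebra.trace (ZMod p) L x := fun x => by
    have := Algebra.trace_eq_of_algEquiv (FiniteField.frobeniusAlgEquiv (ZMod p) L p) x
    simpa using this
  have htr_pow : ∀ (i : ℕ) (x : L),
      Algebra.trace (ZMod p) L (x ^ p ^ i) = Algebra.trace (ZMod p) L x := fun i => by
    induction i with
    | zero => simp
    | succ i ih =>
      intro x
      rw [pow_succ, pow_mul, htr, ih]
  have heq : ((ZMod.stdAddChar (N := p)).compAddMonoidHom
      (Algebra.trace (ZMod p) F).toAddMonoidHom).compAddMonoidHom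
        (Algebra.trace F L).toAddMonoidHom =
      (ZMod.stdAddChar (N := p)).compAddMonoidHom
        (Algebra.trace (ZMod p) L).toAddMonoidHom := by
    ext x
    simp [AddChar.compAddMonoidHom_apply, Algebra.trace_trace]
  refine ⟨(ZMod.stdAddChar (N := p)).compAddMonoidHom
    (Algebra.trace (ZMod p) F).toAddMonoidHom, isPrimitive_stdAddChar_comp_trace p F, ?_⟩
  rw [heq]
  refine ⟨isPrimitive_stdAddChar_comp_trace p L, fun x y => add_pow_char_pow x y p j, fun x => ?_, fun u hu => ?_⟩
  · simp only [AddChar.compAddMonoidHom_apply, LinearMap.toAddMonoidHom_coe]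
    exact congrArg _ (htr_pow j x)
  -- The relation Tr u = Tr u^Q = -Tr u says nothing in characteristic two. Instead, the 2jγ
  -- conjugates of u change sign under a shift by j and cancel in pairs of blocks.
  · have h0 : Algebra.trace (ZMod p) L u = 0 := by
      apply (algebraMap (ZMod p) L).injective
      have hf : Module.finrank (ZMod p) L = γ * (2 * j) := by
        have := Module.card_eq_pow_finrank (K := ZMod p) (V := L)
        rw [hcard, ZMod.card] at this
        rw [← Nat.pow_right_injective hp.two_le this, mul_comm]
      rw [FiniteField.algebraMap_trace_eq_sum_pow, hf, map_zero]
      refine sum_range_two_mul_eq_zero_of_antiperiodic (fun i => ?_) γ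
      rw [Nat.card_zmod, pow_add, mul_comm, pow_mul, hu]
      exact map_neg (iterateFrobenius L p i) u
    simp [AddChar.compAddMonoidHom_apply, h0]

end Trace

/-! ### Counting nonzero traces by power sums -/

section Count

variable {F L : Type*} [Field F] [Field L] [Fintype F] [Fintype L] [Algebra F L] {ω : Lˣ}

theorem exists_algebraMap_eq_of_pow_eq_one (hω : ∀ x : Lˣ, x ∈ Subgroup.zpowers ω)
    (hdvd : Fintype.card F - 1 ∣ Fintype.card L - 1) {x : L} (hx : x ^ (Fintype.card F - 1) = 1) :
    ∃ c : F, c ≠ 0 ∧ algebraMap F L c = x := by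
  classical
  have hF := Fintype.one_lt_card (α := F)
  have h1 := card_pow_eq_one_eq hω (by omega) hdvd
  have h2 : (univ.erase (0 : F)).image (algebraMap F L) =
      univ.filter fun x : L => x ^ (Fintype.card F - 1) = 1 := by
    refine eq_of_subset_of_card_le ?_ ?_
    · intro y hy
      obtain ⟨c, hc, rfl⟩ := mem_image.1 hy
      rw [mem_filter, ← map_pow, FiniteField.pow_card_sub_one_eq_one c (ne_of_mem_erase hc), map_one]
      exact ⟨mem_univ _, rfl⟩
    · rw [card_image_of_injective _ (algebraMap F L).injective, card_erase_of_mem (mem_univ _),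
        card_univ, ← Fintype.card_subtype, ← Nat.card_eq_fintype_card, h1]
  have h3 : x ∈ univ.filter fun x : L => x ^ (Fintype.card F - 1) = 1 := by simpa using hx
  rw [← h2] at h3
  obtain ⟨c, hc, rfl⟩ := mem_image.1 h3
  exact ⟨c, ne_of_mem_erase hc, rfl⟩

/-- The nonzero scalars are powers of ω^{hN}, hence h-th powers. -/
theorem exists_pow_mul_eq_algebraMap (hω : ∀ x : Lˣ, x ∈ Subgroup.zpowers ω) {h N : ℕ}
    (hN : h * N * (Fintype.card F - 1) = Fintype.card L - 1) {c : F} (hc : c ≠ 0) :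
    ∃ v : L, v ≠ 0 ∧ v ^ h = algebraMap F L c := by
  obtain ⟨k, hk⟩ := exists_pow_mul_eq_of_pow_eq_one hω hN
    (x := Units.map (algebraMap F L).toMonoidHom (Units.mk0 c hc)) (by
      ext
      simp [← map_pow, FiniteField.pow_card_sub_one_eq_one c hc])
  refine ⟨((ω ^ (N * k) : Lˣ) : L), Units.ne_zero _, ?_⟩
  rw [← Units.val_pow_eq_pow_val, ← pow_mul, show N * k * h = h * N * k by ring, hk]
  rfl

/-- The number of `i < n` for which `b * ω ^ (h * i)` has nonzero trace. -/
noncomputable def traceCount (F : Type*) {L : Type*} [Field F] [Field L] [Algebra F L]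
    [DecidableEq F] (ω : Lˣ) (h n : ℕ) (b : L) : ℕ :=
  ∑ i ∈ range n, if Algebra.trace F L (b * ((ω ^ (h * i) : Lˣ) : L)) ≠ 0 then 1 else 0

variable [DecidableEq F]

/-- Since ω^{hN} is a (|F|-1)-th root of unity, it lies in F. Shifting i by N therefore multiplies
the trace by a nonzero scalar, and vanishing of the trace is N-periodic in i. -/
theorem traceCount_mul (hω : ∀ x : Lˣ, x ∈ Subgroup.zpowers ω) {h N : ℕ}
    (hN : h * N * (Fintype.card F - 1) = Fintype.card L - 1) (t : ℕ) (b : L) :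
    traceCount F ω h (t * N) b = t * traceCount F ω h N b := by
  obtain ⟨c, hc0, hc⟩ := exists_algebraMap_eq_of_pow_eq_one (F := F) hω (Dvd.intro_left _ hN)
    (x := ((ω ^ (h * N) : Lˣ) : L)) (by
      rw [← Units.val_pow_eq_pow_val, ← pow_mul, hN, generator_pow_card_sub_one, Units.val_one])
  rw [traceCount, sum_range_mul_of_periodic, traceCount, smul_eq_mul]
  intro i
  have : Algebra.trace F L (b * ((ω ^ (h * (i + N)) : Lˣ) : L)) =
      c * Algebra.trace F L (b * ((ω ^ (h * i) : Lˣ) : L)) := by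
    rw [mul_add, pow_add, Units.val_mul, ← hc, ← smul_eq_mul c, ← map_smul, Algebra.smul_def]
    congr 1
    ring
  simp only [this, mul_ne_zero_iff, ne_eq, hc0, not_false_eq_true, true_and]

/-- Summing χ(cT) over c in F detects T = 0. For c ≠ 0 the sum over i does not depend on c, as c is
an h-th power and can be absorbed into x. The range N(|F| - 1) is the full cycle of h-th powers. -/
theorem traceCount_mul_eq (hω : ∀ x : Lˣ, x ∈ Subgroup.zpowers ω) {h N : ℕ}
    (hN : h * N * (Fintype.card F - 1) = Fintype.card L - 1) {χ : AddChar F ℂ}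
    (hχ : χ.IsPrimitive) (b : L) :
    (Fintype.card F : ℂ) * h * traceCount F ω h (N * (Fintype.card F - 1)) b =
      (Fintype.card F - 1) * (Fintype.card L -
        powerSum (χ.compAddMonoidHom (Algebra.trace F L).toAddMonoidHom) h b) := by
  classical
  set ψ := χ.compAddMonoidHom (Algebra.trace F L).toAddMonoidHom with hψ
  set M := N * (Fintype.card F - 1) with hM
  set T : ℕ → F := fun i => Algebra.trace F L (b * ((ω ^ (h * i) : Lˣ) : L)) with hT
  have hL := Fintype.one_lt_card (α := L)
  have hF := Fintype.one_lt_card (α := F)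
  have hh : h ≠ 0 := by
    rintro rfl
    simp at hN
    omega
  have hM' : h * M = Fintype.card L - 1 := by rw [← hN, hM]; ring
  have hsum : ∀ c : F, h * ∑ i ∈ range M, χ (c * T i) =
      if c = 0 then (h : ℂ) * M else powerSum ψ h b - 1 := by
    intro c
    split_ifs with hc
    · simp [hc]
    · obtain ⟨v, hv0, hv⟩ := exists_pow_mul_eq_algebraMap hω hN hc
      rw [← powerSum_mul_pow h b hv0, powerSum_eq_one_add_mul hω hh hM' (b * v ^ h)]
      rw [add_sub_cancel_left]
      congr 1
      refine sum_congr rfl fun i _ => ?_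
      rw [hψ, AddChar.compAddMonoidHom_apply, hv, hT]
      congr 1
      rw [LinearMap.toAddMonoidHom_coe, ← smul_eq_mul c, ← map_smul, Algebra.smul_def]
      congr 1
      ring
  have htot : ∑ c : F, ∑ i ∈ range M, χ (c * T i) =
      Fintype.card F * (M - traceCount F ω h M b) := by
    rw [sum_comm]
    have hW : (traceCount F ω h M b : ℂ) = ∑ i ∈ range M, if T i ≠ 0 then 1 else 0 := by
      simp only [traceCount, Nat.cast_sum, Nat.cast_ite, Nat.cast_one, Nat.cast_zero, hT]
    simp only [AddChar.sum_mulShift _ hχ, Nat.cast_ite, Nat.cast_zero]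
    rw [hW]
    have hM1 : (M : ℂ) = ∑ i ∈ range M, 1 := by simp
    rw [hM1, ← sum_sub_distrib, mul_sum]
    refine sum_congr rfl fun i _ => ?_
    by_cases h0 : T i = 0
    · rw [if_pos h0, if_neg (not_not.2 h0), sub_zero, mul_one]
    · rw [if_neg h0, if_pos h0, sub_self, mul_zero]
  have h2 : h * ∑ c : F, ∑ i ∈ range M, χ (c * T i) =
      h * M + (Fintype.card F - 1) * (powerSum ψ h b - 1) := by
    rw [mul_sum]
    simp only [hsum]
    rw [← add_sum_erase univ _ (mem_univ (0 : F)), if_pos rfl]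
    congr 1
    rw [sum_congr rfl fun c hc => if_neg (ne_of_mem_erase hc), sum_const, nsmul_eq_mul,
      card_erase_of_mem (mem_univ _), card_univ, Nat.cast_sub hF.le, Nat.cast_one]
  have h3 : (h : ℂ) * M = Fintype.card L - 1 := by
    have := congrArg (Nat.cast : ℕ → ℂ) hM'
    rwa [Nat.cast_mul, Nat.cast_sub hL.le, Nat.cast_one] at this
  rw [htot] at h2
  linear_combination -h2 + (Fintype.card F - 1 : ℂ) * h3

end Count

/-! ### Hamming weights of the codewords -/

section Hamming

variable {F E L : Type*} [Field F] [Field E] [Field L] [Fintype E] [Fintype L]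
  [DecidableEq F] [DecidableEq L] [Algebra F E] [Algebra F L] [Algebra E L] {ω : Lˣ}

theorem sum_definingSetK {E L : Type*} [Fintype E] [Field L] [Fintype L] [DecidableEq L] {ω : Lˣ} {M : Type*} [AddCommMonoid M] {h n : ℕ}
    (hω : ∀ x : Lˣ, x ∈ Subgroup.zpowers ω) (hn : h * n ≤ Fintype.card L - 1) (hh : 0 < h)
    (f : E × L → M) :
    ∑ z : ↥(definingSetK E ω h n), f z =
      ∑ i ∈ range n, ∑ x : E, f (x, ((ω ^ (h * i) : Lˣ) : L)) := by
  rw [sum_coe_sort (definingSetK E ω h n) f, definingSetK, sum_product_right, definingSetD, sum_image]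
  intro i hi j hj hij
  have hlt : ∀ k ∈ (range n : Set ℕ), h * k < orderOf ω := fun k hk => by
    rw [orderOf_generator hω]
    exact (Nat.mul_lt_mul_of_pos_left (mem_range.1 hk) hh).trans_le hn
  exact Nat.eq_of_mul_eq_mul_left hh (pow_injOn_Iio_orderOf (hlt i hi) (hlt j hj) (Units.ext hij))

theorem card_definingSetK {E L : Type*} [Fintype E] [Field L] [Fintype L] [DecidableEq L] {ω : Lˣ} {h n : ℕ} (hω : ∀ x : Lˣ, x ∈ Subgroup.zpowers ω)
    (hn : h * n ≤ Fintype.card L - 1) (hh : 0 < h) :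
    Fintype.card ↥(definingSetK E ω h n) = n * Fintype.card E := by
  have := sum_definingSetK (E := E) hω hn hh (fun _ => 1)
  simpa using this

theorem hammingNorm_codewordK {h n : ℕ} (hω : ∀ x : Lˣ, x ∈ Subgroup.zpowers ω)
    (hn : h * n ≤ Fintype.card L - 1) (hh : 0 < h) (a : E) (b : L) :
    hammingNorm (codewordK F (definingSetK E ω h n) a b) =
      (∑ i ∈ range n, ∑ x : E,
        if Algebra.trace F E (a * x) + Algebra.trace F L (b * ((ω ^ (h * i) : Lˣ) : L)) ≠ 0
          then 1 else 0) +
      ∑ i ∈ range n, ∑ x : E,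
        if Algebra.trace F E (a * x) +
          Algebra.trace F L ((algebraMap E L a + b) * ((ω ^ (h * i) : Lˣ) : L)) ≠ 0
          then 1 else 0 := by
  rw [hammingNorm, card_filter, Fintype.sum_sum_type]
  exact congrArg₂ (· + ·)
    (sum_definingSetK hω hn hh fun z =>
      if Algebra.trace F E (a * z.1) + Algebra.trace F L (b * z.2) ≠ 0 then 1 else 0)
    (sum_definingSetK hω hn hh fun z =>
      if Algebra.trace F E (a * z.1) + Algebra.trace F L ((algebraMap E L a + b) * z.2) ≠ 0
        then 1 else 0)

theorem card_mul_card_filter_eq_of_surjective {A B : Type*} [AddGroup A] [AddGroup B] [Fintype A]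
    [Fintype B] [DecidableEq B] {f : A →+ B} (hf : Function.Surjective f) (c : B) :
    Fintype.card B * #{x | f x = c} = Fintype.card A := by
  have h1 : ∀ c', #{x | f x = c'} = #{x | f x = c} := fun c' =>
    AddMonoidHom.card_fiber_eq_of_mem_range f (hf c') (hf c)
  have h2 := card_eq_sum_card_fiberwise (f := f) (s := univ) (t := univ) (fun _ _ => by simp)
  simp only [h1, sum_const, smul_eq_mul, card_univ] at h2
  exact h2.symm

/-- For a ≠ 0 the map x ↦ Tr(ax) is a surjective homomorphism, so all its fibres, in particular that
over -c, have e elements. -/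
theorem sum_trace_add_ne_zero [Fintype F] {a : E} (ha : a ≠ 0) (c : F) {e : ℕ}
    (he : Fintype.card E = Fintype.card F * e) :
    (∑ x : E, if Algebra.trace F E (a * x) + c ≠ 0 then 1 else 0) = (Fintype.card F - 1) * e := by
  have : Module.Finite F E := Module.Finite.of_finite
  have : Algebra.IsAlgebraic F E := Algebra.IsAlgebraic.of_finite F E
  have : Algebra.IsSeparable F E := Algebra.IsAlgebraic.isSeparable_of_perfectField
  let f : E →+ F := (Algebra.trace F E).toAddMonoidHom.comp (AddMonoidHom.mulLeft a)
  have hf : Function.Surjective f := (Algebra.trace_surjective F E).comp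
    fun y => ⟨a⁻¹ * y, by simp [ha]⟩
  have h1 := card_mul_card_filter_eq_of_surjective hf (-c)
  rw [he] at h1
  have h2 := Nat.eq_of_mul_eq_mul_left Fintype.card_pos h1
  have h3 := card_filter_add_card_filter_not (s := univ) (fun x => f x = -c)
  rw [h2, card_univ, he] at h3
  rw [← card_filter, Nat.sub_mul, one_mul, ← h3, Nat.add_sub_cancel_left]
  exact congrArg card (filter_congr fun x _ => not_congr add_eq_zero_iff_eq_neg)

theorem hammingNorm_codewordK_of_ne_zero [Fintype F] {h n e : ℕ} (hω : ∀ x : Lˣ, x ∈ Subgroup.zpowers ω)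
    (hn : h * n ≤ Fintype.card L - 1) (hh : 0 < h) (he : Fintype.card E = Fintype.card F * e)
    {a : E} (ha : a ≠ 0) (b : L) :
    hammingNorm (codewordK F (definingSetK E ω h n) a b) = 2 * n * ((Fintype.card F - 1) * e) := by
  rw [hammingNorm_codewordK hω hn hh]
  simp only [sum_trace_add_ne_zero ha _ he, sum_const, card_range, smul_eq_mul]
  ring

theorem hammingNorm_codewordK_zero {h n : ℕ} (hω : ∀ x : Lˣ, x ∈ Subgroup.zpowers ω)
    (hn : h * n ≤ Fintype.card L - 1) (hh : 0 < h) (b : L) :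
    hammingNorm (codewordK F (definingSetK E ω h n) 0 b) =
      2 * Fintype.card E * traceCount F ω h n b := by
  rw [hammingNorm_codewordK hω hn hh]
  simp only [zero_mul, map_zero, zero_add, sum_const, card_univ, smul_eq_mul, ← mul_sum]
  rw [← traceCount]
  ring

end Hamming

/-! ### From weights of codewords to parameters of the code -/

section Code

variable {F E L : Type*} [Field F] [Field E] [Field L] [Algebra F E] [Algebra F L] [Algebra E L]

theorem codewordK_sub (K : Finset (E × L)) (a a' : E) (b b' : L) :
    codewordK F K a b - codewordK F K a' b' = codewordK F K (a - a') (b - b') := by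
  ext (z | z) <;>
  simp only [codewordK, Pi.sub_apply, Sum.elim_inl, Sum.elim_inr, sub_mul, add_mul, map_sub,
    map_add] <;> ring

theorem codewordK_zero (K : Finset (E × L)) : codewordK F K 0 0 = 0 := by
  ext (z | z) <;> simp [codewordK]

variable [DecidableEq F]

/-- The word is additive in (a, b), so nonvanishing of the weights off (0, 0) says that the kernel
is trivial. -/
theorem codewordK_injective {K : Finset (E × L)}
    (hK : ∀ a b, (a, b) ≠ (0, 0) → hammingNorm (codewordK F K a b) ≠ 0) :
    Function.Injective fun x : E × L => codewordK F K x.1 x.2 := by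
  rintro ⟨a, b⟩ ⟨a', b'⟩ hab
  have h1 : codewordK F K (a - a') (b - b') = 0 := by
    rw [← codewordK_sub]
    exact sub_eq_zero.2 hab
  by_contra hne
  refine hK (a - a') (b - b') (fun h0 => hne ?_) (by rw [h1, hammingNorm_zero])
  simp only [Prod.mk.injEq, sub_eq_zero] at h0
  exact Prod.ext h0.1 h0.2

variable [IsScalarTower F E L]

theorem weightCount_codeK_eq_sum [Fintype E] [Fintype L] {K : Finset (E × L)}
    (hK : ∀ a b, (a, b) ≠ (0, 0) → hammingNorm (codewordK F K a b) ≠ 0) (i : ℕ) :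
    weightCount (codeK F K) i =
      ∑ a : E, ∑ b : L, if hammingNorm (codewordK F K a b) = i then 1 else 0 := by
  have h1 : {c | c ∈ codeK F K ∧ hammingNorm c = i} =
      (fun x : E × L => codewordK F K x.1 x.2) ''
        ((univ.filter fun x : E × L => hammingNorm (codewordK F K x.1 x.2) = i : Finset (E × L)) :
          Set (E × L)) := by
    ext c
    simp only [Set.mem_image, coe_filter, mem_univ, true_and, Set.mem_ofPred_eq, Prod.exists]
    constructor
    · rintro ⟨⟨a, b, rfl⟩, hc⟩
      exact ⟨a, b, hc, rfl⟩
    · rintro ⟨a, b, hc, rfl⟩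
      exact ⟨⟨a, b, rfl⟩, hc⟩
  rw [weightCount, h1, Set.ncard_image_of_injective _ (codewordK_injective hK),
    Set.ncard_coe_finset, card_filter, Fintype.sum_prod_type]

theorem finrank_codeK [Fintype F] [Fintype E] [Fintype L] {K : Finset (E × L)}
    (hK : ∀ a b, (a, b) ≠ (0, 0) → hammingNorm (codewordK F K a b) ≠ 0) :
    Module.finrank F (codeK F K) = Module.finrank F L + Module.finrank F E := by
  have h1 : Nat.card (codeK F K) = Nat.card (E × L) := by
    refine (Nat.card_congr (Equiv.ofBijective (fun x => ⟨codewordK F K x.1 x.2, x.1, x.2, rfl⟩)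
      ⟨fun x y hxy => codewordK_injective hK (congrArg Subtype.val hxy), ?_⟩)).symm
    rintro ⟨c, a, b, rfl⟩
    exact ⟨(a, b), rfl⟩
  rw [Nat.card_prod, Module.natCard_eq_pow_finrank (K := F) (V := codeK F K),
    Module.natCard_eq_pow_finrank (K := F) (V := E), Module.natCard_eq_pow_finrank (K := F) (V := L),
    ← pow_add, Nat.card_eq_fintype_card] at h1
  rw [Nat.pow_right_injective Fintype.one_lt_card h1, add_comm]

/-- The pairs (a, b) split into a ≠ 0, the zero pair, and a = 0 with b = ω^e, the last sorted by e ≡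
e₀ mod h. A sum of indicators is used so that the count holds before the weights are known to be
distinct. -/
theorem weightCount_codeK [Fintype E] [Fintype L] {ω : Lˣ}
    (hω : ∀ x : Lˣ, x ∈ Subgroup.zpowers ω) {K : Finset (E × L)} {h e₀ w₁ w₂ w₃ : ℕ}
    (hK : ∀ a b, (a, b) ≠ (0, 0) → hammingNorm (codewordK F K a b) ≠ 0)
    (hh : 0 < h) (hdvd : h ∣ Fintype.card L - 1)
    (hw₁ : ∀ a b, a ≠ 0 → hammingNorm (codewordK F K a b) = w₁)
    (hw : ∀ e : ℕ, hammingNorm (codewordK F K 0 ((ω ^ e : Lˣ) : L)) =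
      if (h : ℤ) ∣ (e : ℤ) - e₀ then w₂ else w₃) (i : ℕ) :
    weightCount (codeK F K) i = (if 0 = i then 1 else 0) +
      (if w₁ = i then (Fintype.card E - 1) * Fintype.card L else 0) +
      (if w₂ = i then (Fintype.card L - 1) / h else 0) +
      (if w₃ = i then (Fintype.card L - 1) - (Fintype.card L - 1) / h else 0) := by
  classical
  have h1 : ∀ a ∈ univ.erase (0 : E),
      (∑ b : L, if hammingNorm (codewordK F K a b) = i then 1 else 0) =
        if w₁ = i then Fintype.card L else 0 := by
    intro a ha
    simp only [hw₁ a _ (ne_of_mem_erase ha)]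
    simp
  have hc := card_filter_range_dvd hh hdvd e₀
  have hc' := card_filter_add_card_filter_not (s := range (Fintype.card L - 1))
    (fun i : ℕ => (h : ℤ) ∣ (i : ℤ) - e₀)
  rw [hc, card_range] at hc'
  have hsplit : ∀ e : ℕ, (if (if (h : ℤ) ∣ (e : ℤ) - e₀ then w₂ else w₃) = i then 1 else 0) =
      (if w₂ = i then 1 else 0) * (if (h : ℤ) ∣ (e : ℤ) - e₀ then 1 else 0) +
      (if w₃ = i then 1 else 0) * (if ¬(h : ℤ) ∣ (e : ℤ) - e₀ then 1 else 0) := by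
    intro e
    by_cases hd : (h : ℤ) ∣ (e : ℤ) - e₀ <;> simp [hd]
  rw [weightCount_codeK_eq_sum hK, ← add_sum_erase univ _ (mem_univ (0 : E)), sum_congr rfl h1,
    sum_eq_zero_add_sum_range hω, codewordK_zero, hammingNorm_zero, sum_const,
    card_erase_of_mem (mem_univ _), card_univ]
  simp only [hw, hsplit]
  rw [sum_add_distrib, ← mul_sum, ← mul_sum, ← card_filter, ← card_filter, hc,
    ← Nat.sub_eq_of_eq_add' hc'.symm]
  simp only [smul_eq_mul, mul_ite, mul_zero, ite_mul, one_mul, zero_mul]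
  ring

theorem isLinearCodeWithParams_codeK [Fintype F] [Fintype E] [Fintype L] {K : Finset (E × L)} {N d : ℕ}
    (hK : ∀ a b, (a, b) ≠ (0, 0) → hammingNorm (codewordK F K a b) ≠ 0)
    (hN : Fintype.card (↥K ⊕ ↥K) = N)
    (hd : ∃ a b, (a, b) ≠ (0, 0) ∧ hammingNorm (codewordK F K a b) = d)
    (hle : ∀ a b, (a, b) ≠ (0, 0) → d ≤ hammingNorm (codewordK F K a b)) :
    IsLinearCodeWithParams (codeK F K) N (Module.finrank F L + Module.finrank F E) d := by
  refine ⟨hN, finrank_codeK hK, ?_, ?_⟩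
  · obtain ⟨a, b, hab, hd⟩ := hd
    refine ⟨codewordK F K a b, ⟨a, b, rfl⟩, 0, Submodule.zero_mem _, fun h0 => ?_, ?_⟩
    · exact hK a b hab (by rw [h0, hammingNorm_zero])
    · rw [hammingDist_zero_right, hd]
  · rintro t ⟨_, ⟨a, b, rfl⟩, _, ⟨a', b', rfl⟩, hne, rfl⟩
    rw [hammingDist_eq_hammingNorm, neg_add_eq_sub, codewordK_sub]
    refine hle _ _ fun h0 => hne ?_
    simp only [Prod.mk.injEq, sub_eq_zero] at h0
    rw [h0.1, h0.2]

end Code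

/-! ### Assembly of the weight distribution -/

theorem isWeightCode_three {F ι : Type*} [Field F] [DecidableEq F] [Fintype ι]
    {C : Submodule F (ι → F)} {w₁ w₂ w₃ : ℕ} (hnodup : [0, w₁, w₂, w₃].Nodup)
    (h₁ : weightCount C w₁ ≠ 0) (h₂ : weightCount C w₂ ≠ 0) (h₃ : weightCount C w₃ ≠ 0)
    (h : ∀ i ∉ [0, w₁, w₂, w₃], weightCount C i = 0) : IsWeightCode C 3 := by
  simp only [List.nodup_cons, List.mem_cons, List.not_mem_nil, or_false, not_or] at hnodup h
  obtain ⟨⟨h01, h02, h03⟩, ⟨h12, h13⟩, h23, -⟩ := hnodup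
  have hle : ∀ i, weightCount C i ≠ 0 → i ≤ Fintype.card ι := by
    intro i hi
    obtain ⟨c, -, rfl⟩ := Set.nonempty_of_ncard_ne_zero hi
    exact hammingNorm_le_card_fintype
  have : (Icc 1 (Fintype.card ι)).filter (fun i => weightCount C i ≠ 0) = {w₁, w₂, w₃} := by
    ext i
    simp only [mem_filter, mem_Icc, mem_insert, mem_singleton]
    constructor
    · rintro ⟨⟨hi, -⟩, hc⟩
      by_contra hn
      simp only [not_or] at hn
      exact hc (h i ⟨by omega, hn.1, hn.2.1, hn.2.2⟩)
    · rintro (rfl | rfl | rfl)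
      exacts [⟨⟨by omega, hle _ h₁⟩, h₁⟩, ⟨⟨by omega, hle _ h₂⟩, h₂⟩, ⟨⟨by omega, hle _ h₃⟩, h₃⟩]
  rw [IsWeightCode, this, card_insert_of_notMem (by simp [h12, h13]),
    card_insert_of_notMem (by simpa using h23), card_singleton]

-- The count for a full cycle is reduced to N by periodicity and then scaled by t. Denominators are
-- cleared so that no quotient of cardinalities appears.
open Classical in
theorem exists_traceCount_eq {F L : Type*} [Field F] [Field L] [Fintype F] [Fintype L]
    [DecidableEq F] [Algebra F L] {ω : Lˣ} {p j γ h N t : ℕ} (hp : p.Prime)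
    (hω : ∀ x : Lˣ, x ∈ Subgroup.zpowers ω) (hcard : Fintype.card L = p ^ (2 * j * γ))
    (hh : h ∣ p ^ j + 1) (hN : h * N * (Fintype.card F - 1) = Fintype.card L - 1) :
    ∃ e₀ : ℕ, ∀ e : ℕ,
      (Fintype.card F : ℝ) * (Fintype.card L - 1) * traceCount F ω h (t * N) ((ω ^ e : Lˣ) : L) =
        (t * N : ℕ) * (Fintype.card F - 1) * (p ^ j) ^ γ * ((p ^ j) ^ γ -
          (-1) ^ γ * (1 - h * if (h : ℤ) ∣ (e : ℤ) - e₀ then 1 else 0)) := by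
  obtain ⟨χ, hχ, hψ⟩ := exists_isFrobeniusChar F L hp hcard
  have hcard' : Fintype.card L = (p ^ j) ^ (2 * γ) := by rw [hcard, ← pow_mul]; ring_nf
  obtain ⟨e₀, he₀⟩ := hψ.exists_pow_eq_neg_one hω hcard'
  refine ⟨e₀, fun e => ?_⟩
  have h1 := traceCount_mul_eq hω hN hχ ((ω ^ e : Lˣ) : L)
  rw [hψ.powerSum_eq hω hcard' hh he₀, mul_comm N, traceCount_mul hω hN] at h1
  rw [traceCount_mul hω hN]
  set W := traceCount F ω h N ((ω ^ e : Lˣ) : L)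
  have hL := Fintype.one_lt_card (α := L)
  have hF := Fintype.one_lt_card (α := F)
  have h2 : (Fintype.card F : ℝ) * h * ((Fintype.card F - 1 : ℕ) * W) = (Fintype.card F - 1) *
      (Fintype.card L - (-1) ^ γ * (p ^ j) ^ γ *
        (1 - h * if (h : ℤ) ∣ (e : ℤ) - e₀ then 1 else 0)) := by
    -- The character sums live in ℂ, but their values are real, so the identity descends to ℝ.
    apply Complex.ofReal_injective
    split_ifs at h1 ⊢ <;> push_cast at h1 ⊢ <;> exact h1
  have h3 : (h : ℝ) * N * (Fintype.card F - 1) = Fintype.card L - 1 := by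
    have := congrArg (Nat.cast : ℕ → ℝ) hN
    rwa [Nat.cast_mul, Nat.cast_mul, Nat.cast_sub hL.le, Nat.cast_sub hF.le, Nat.cast_one] at this
  have h4 : (Fintype.card L : ℝ) = (p ^ j) ^ γ * (p ^ j) ^ γ := by
    rw [hcard', two_mul, pow_add]
    push_cast
    rfl
  have hF0 : ((Fintype.card F : ℝ) - 1) ≠ 0 := by
    have : (1 : ℝ) < Fintype.card F := by exact_mod_cast hF
    linarith
  rw [Nat.cast_sub hF.le, Nat.cast_one, show (Fintype.card F : ℝ) * h * ((Fintype.card F - 1) * W) =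
    (Fintype.card F - 1) * (Fintype.card F * h * W) by ring] at h2
  have h5 := mul_left_cancel₀ hF0 h2
  rw [h4] at h5
  rw [← h3]
  push_cast
  linear_combination (t : ℝ) * N * (Fintype.card F - 1) * h5

/-- The order relations between the three weights `A * (R - R⁻¹)`, `A * (R + (-1) ^ γ * (h - 1))`
and `A * (R - (-1) ^ γ)`. -/
theorem weights_order {A R h w₁ w₂ w₃ : ℝ} {γ : ℕ} (hA : 0 < A) (hR : 1 < R) (hh : 2 ≤ h)
    (hhR : h < R + 1) (h₁ : w₁ * R = A * (R ^ 2 - 1)) (h₂ : w₂ = A * (R + (-1) ^ γ * (h - 1)))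
    (h₃ : w₃ = A * (R + (-1) ^ (γ + 1))) :
    (Even γ ∧ 0 < w₃ ∧ w₃ < w₁ ∧ w₁ < w₂) ∨ (¬ Even γ ∧ 0 < w₂ ∧ w₂ < w₁ ∧ w₁ < w₃) := by
  have hR0 : 0 < R := by linarith
  have hAR : 0 < A * (R - 1) := mul_pos hA (by linarith)
  rcases Nat.even_or_odd γ with hγ | hγ
  · rw [hγ.neg_one_pow] at h₂
    rw [hγ.add_one.neg_one_pow] at h₃
    refine Or.inl ⟨hγ, by linarith, ?_, ?_⟩
    · refine lt_of_mul_lt_mul_right ?_ hR0.le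
      rw [h₁, h₃]
      linarith
    · refine lt_of_mul_lt_mul_right ?_ hR0.le
      rw [h₁, h₂]
      have : 0 < A * (R * (h - 1)) := mul_pos hA (mul_pos hR0 (by linarith))
      linarith
  · rw [hγ.neg_one_pow] at h₂
    rw [hγ.add_one.neg_one_pow] at h₃
    refine Or.inr ⟨Nat.not_even_iff_odd.2 hγ, ?_, ?_, ?_⟩
    · rw [h₂]
      -- The factor is R - (h - 1), positive because h < R + 1.
      exact mul_pos hA (by linarith)
    · refine lt_of_mul_lt_mul_right ?_ hR0.le
      rw [h₁, h₂]
      -- The difference is A(R(h - 1) - 1) = A(R(h - 2) + (R - 1)), still strictly positive when h =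
      -- 2.
      have : 0 ≤ A * (R * (h - 2)) := mul_nonneg hA.le (mul_nonneg hR0.le (by linarith))
      linarith
    · refine lt_of_mul_lt_mul_right ?_ hR0.le
      rw [h₁, h₃]
      have : 0 < A * R := mul_pos hA hR0
      linarith

theorem rpow_half_eq {q m : ℕ} {R : ℝ} (hR : 0 ≤ R) (h : (q : ℝ) ^ m = R ^ 2) :
    (q : ℝ) ^ ((m : ℝ) / 2) = R := by
  have hq : (0 : ℝ) ≤ q := Nat.cast_nonneg q
  refine (sq_eq_sq₀ (Real.rpow_nonneg hq _) hR).1 ?_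
  rw [← h, ← Real.rpow_natCast, ← Real.rpow_mul hq, Nat.cast_ofNat, div_mul_cancel₀ _ two_ne_zero,
    Real.rpow_natCast]

theorem corollaryh3
    {F E L : Type*} [Field F] [Field E] [Field L] [Fintype F] [Fintype E] [Fintype L]
    [DecidableEq F] [DecidableEq L]
    [Algebra F E] [Algebra F L] [Algebra E L] [IsScalarTower F E L]
    (p q m m₁ h n j γ : ℕ) (hp : p.Prime)
    (hq : Fintype.card F = q) (hm : Module.finrank F L = m) (hm₁ : Module.finrank F E = m₁)
    (ω : Lˣ) (hω : ∀ x : Lˣ, x ∈ Subgroup.zpowers ω)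
    (hh : h ∣ (q ^ m - 1) / (q - 1))
    (hn : (q ^ m - 1) / (h * (q - 1)) ∣ n) (hn0 : 0 < n) (hn1 : n ≤ (q ^ m - 1) / h)
    (hh2 : 2 ≤ h) (hhlt : (h : ℝ) < (q : ℝ) ^ ((m : ℝ) / 2) + 1)
    (hqm : q ^ m = p ^ (2 * j * γ))
    (hj : IsLeast {i : ℕ | 0 < i ∧ h ∣ p ^ i + 1} j) :
    ∃ d w₁ w₂ w₃ : ℕ,
      (d : ℝ) =
        (if Even γ then
          2 * n * (q : ℝ) ^ ((m : ℝ) / 2 + m₁ - 1) * (q - 1) / ((q : ℝ) ^ m - 1)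
            * ((q : ℝ) ^ ((m : ℝ) / 2) - 1)
        else
          2 * n * (q : ℝ) ^ ((m : ℝ) / 2 + m₁ - 1) * (q - 1) / ((q : ℝ) ^ m - 1)
            * ((q : ℝ) ^ ((m : ℝ) / 2) - h + 1)) ∧
      (w₁ : ℝ) = 2 * n * (q : ℝ) ^ ((m₁ : ℝ) - 1) * (q - 1) ∧
      (w₂ : ℝ) = 2 * n * (q : ℝ) ^ ((m : ℝ) / 2 + m₁ - 1) * (q - 1) / ((q : ℝ) ^ m - 1)
            * ((q : ℝ) ^ ((m : ℝ) / 2) + (-1) ^ γ * (h - 1)) ∧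
      (w₃ : ℝ) = 2 * n * (q : ℝ) ^ ((m : ℝ) / 2 + m₁ - 1) * (q - 1) / ((q : ℝ) ^ m - 1)
            * ((q : ℝ) ^ ((m : ℝ) / 2) + (-1) ^ (γ + 1)) ∧
      -- the four weights of the table are pairwise distinct
      [0, w₁, w₂, w₃].Nodup ∧
      IsLinearCodeWithParams (codeK F (definingSetK E ω h n)) (2 * n * q ^ m₁) (m + m₁) d ∧
      IsWeightCode (codeK F (definingSetK E ω h n)) 3 ∧
      -- the weight distribution
      weightCount (codeK F (definingSetK E ω h n)) 0 = 1 ∧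
      (weightCount (codeK F (definingSetK E ω h n)) w₁ : ℝ) = (q : ℝ) ^ (m₁ + m) - (q : ℝ) ^ m ∧
      (weightCount (codeK F (definingSetK E ω h n)) w₂ : ℝ) = ((q : ℝ) ^ m - 1) / h ∧
      (weightCount (codeK F (definingSetK E ω h n)) w₃ : ℝ) =
        ((q : ℝ) ^ m - 1) * (h - 1) / h ∧
      ∀ i : ℕ, i ∉ [0, w₁, w₂, w₃] →
        weightCount (codeK F (definingSetK E ω h n)) i = 0 := by
  
  classical
  obtain ⟨-, hj⟩ := hj.1
  have hcard : Fintype.card L = q ^ m := by rw [← hq, ← hm, Module.card_eq_pow_finrank (K := F)]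
  have hcardE : Fintype.card E = q ^ m₁ := by rw [← hq, ← hm₁, Module.card_eq_pow_finrank (K := F)]
  have hm₁0 : 0 < m₁ := hm₁ ▸ Module.finrank_pos
  have hm₁' : q ^ m₁ = q * q ^ (m₁ - 1) := by rw [← pow_succ', Nat.sub_add_cancel hm₁0]
  have hq1 : 1 < q := hq ▸ Fintype.one_lt_card
  have hr1 : 1 < q ^ m := hcard ▸ Fintype.one_lt_card
  have hh0 : 0 < h := by omega
  obtain ⟨N, hN⟩ := hh
  have hG : (q ^ m - 1) / (q - 1) * (q - 1) = q ^ m - 1 :=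
    Nat.div_mul_cancel (by simpa using Nat.sub_dvd_pow_sub_pow q 1 m)
  have hN' : h * N * (q - 1) = q ^ m - 1 := by rw [← hN, hG]
  have hdvd : h ∣ q ^ m - 1 := ⟨N * (q - 1), by rw [← hN', mul_assoc]⟩
  have hhn : h * n ≤ q ^ m - 1 := (Nat.mul_le_mul_left h hn1).trans (Nat.mul_div_le _ _)
  -- The divisor of n in the hypothesis becomes N, whence n = tN.
  rw [mul_comm h, ← Nat.div_div_eq_div_mul, hN, Nat.mul_div_cancel_left _ hh0] at hn
  obtain ⟨t, hn⟩ := hn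
  rw [mul_comm] at hn
  obtain ⟨e₀, he₀⟩ := exists_traceCount_eq (F := F) (t := t) hp hω (hcard.trans hqm) hj
    (by rw [hq, hcard, hN'])
  rw [hq, hcard, ← hn] at he₀
  push_cast at he₀
  have hn0' : (0 : ℝ) < n := by exact_mod_cast hn0
  have hq1' : (1 : ℝ) < q := by exact_mod_cast hq1
  have hr1' : (1 : ℝ) < (q : ℝ) ^ m := by exact_mod_cast hr1
  -- R = p^{jγ} is q^{m/2}; it replaces the real powers throughout.
  set R : ℝ := ((p : ℝ) ^ j) ^ γ with hRdef
  have hR2 : (q : ℝ) ^ m = R ^ 2 := by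
    rw [hRdef, ← pow_mul, ← pow_mul]
    have := congrArg (Nat.cast : ℕ → ℝ) hqm
    push_cast at this
    rw [this]
    ring_nf
  have hR0 : 0 ≤ R := by positivity
  have hR1 : 1 < R := by
    by_contra hle
    rw [hR2] at hr1'
    exact absurd (pow_le_one₀ hR0 (not_lt.1 hle)) (not_le.2 hr1')
  set ε : ℝ := (q : ℝ) ^ (m₁ - 1) with hε
  have hε0 : 0 < ε := by positivity
  have hx1 : (q : ℝ) ^ ((m₁ : ℝ) - 1) = ε := by
    rw [hε, ← Real.rpow_natCast, Nat.cast_sub hm₁0, Nat.cast_one]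
  have hx2 : (q : ℝ) ^ ((m : ℝ) / 2 + m₁ - 1) = R * ε := by
    rw [add_sub_assoc, Real.rpow_add (by linarith), rpow_half_eq hR0 hR2, hx1]
  rw [rpow_half_eq hR0 hR2] at hhlt
  rw [hx1, hx2, rpow_half_eq hR0 hR2]
  set A : ℝ := 2 * n * (R * ε) * (q - 1) / ((q : ℝ) ^ m - 1) with hA
  have hrpos : 0 < (q : ℝ) ^ m - 1 := by linarith
  have hqpos : 0 < (q : ℝ) - 1 := by linarith
  have hApos : 0 < A := by positivity
  have hweight : ∀ e : ℕ, ((2 * q ^ m₁ * traceCount F ω h n ((ω ^ e : Lˣ) : L) : ℕ) : ℝ) =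
      A * (R - (-1) ^ γ * (1 - h * if (h : ℤ) ∣ (e : ℤ) - e₀ then 1 else 0)) := by
    intro e
    rw [hA, div_mul_eq_mul_div, eq_div_iff hrpos.ne', hm₁']
    push_cast
    rw [← hε]
    linear_combination 2 * ε * he₀ e
  -- As h ≥ 2, the exponent e₀ + 1 lies outside the exceptional class and represents the other one.
  have hne : ¬ (h : ℤ) ∣ ((e₀ + 1 : ℕ) : ℤ) - e₀ := by
    rw [Nat.cast_add, add_sub_cancel_left, Nat.cast_one]
    intro hd
    have := Int.le_of_dvd one_pos hd
    omega
  set K := definingSetK E ω h n with hK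
  obtain ⟨w₁, hw₁⟩ : ∃ w, w = 2 * n * ((q - 1) * q ^ (m₁ - 1)) := ⟨_, rfl⟩
  -- Taking w₂ and w₃ as weights of actual words makes them natural numbers; their closed forms are
  -- derived afterwards.
  obtain ⟨w₂, hw₂⟩ : ∃ w, w = 2 * q ^ m₁ * traceCount F ω h n ((ω ^ e₀ : Lˣ) : L) := ⟨_, rfl⟩
  obtain ⟨w₃, hw₃⟩ : ∃ w, w = 2 * q ^ m₁ * traceCount F ω h n ((ω ^ (e₀ + 1) : Lˣ) : L) := ⟨_, rfl⟩
  have hw₁' : (w₁ : ℝ) = 2 * n * ε * (q - 1) := by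
    rw [hw₁]
    push_cast [Nat.cast_sub hq1.le]
    ring
  have hw₂' : (w₂ : ℝ) = A * (R + (-1) ^ γ * (h - 1)) := by
    rw [hw₂, hweight, sub_self, if_pos (dvd_zero _)]
    ring
  have hw₃' : (w₃ : ℝ) = A * (R + (-1) ^ (γ + 1)) := by
    rw [hw₃, hweight, if_neg hne]
    ring
  have hnorm₁ : ∀ (a : E) (b : L), a ≠ 0 → hammingNorm (codewordK F K a b) = w₁ := by
    intro a b ha
    rw [hammingNorm_codewordK_of_ne_zero hω (by rwa [hcard]) hh0
      (by rw [hcardE, hq, hm₁']) ha, hq, hw₁]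
  have hnorm : ∀ e : ℕ, hammingNorm (codewordK F K 0 ((ω ^ e : Lˣ) : L)) =
      if (h : ℤ) ∣ (e : ℤ) - e₀ then w₂ else w₃ := by
    intro e
    rw [hammingNorm_codewordK_zero hω (by rwa [hcard]) hh0, hcardE]
    apply Nat.cast_injective (R := ℝ)
    rw [hweight]
    split_ifs
    · rw [hw₂']; ring
    · rw [hw₃']; ring
  have horder := weights_order (w₁ := w₁) (w₂ := w₂) (w₃ := w₃) hApos hR1
    (by exact_mod_cast hh2) hhlt (by
      rw [hw₁', hA, hR2]
      rw [hR2] at hrpos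
      field_simp) hw₂' hw₃'
  -- The order relations return to ℕ, where `omega` settles positivity, distinctness and the
  -- minimum.
  norm_cast at horder
  have hcases : ∀ (a : E) (b : L), (a, b) ≠ (0, 0) → hammingNorm (codewordK F K a b) = w₁ ∨
      hammingNorm (codewordK F K a b) = w₂ ∨ hammingNorm (codewordK F K a b) = w₃ := by
    intro a b hab
    by_cases ha : a = 0
    · subst ha
      obtain ⟨e, he⟩ := exists_pow_eq hω (Units.mk0 b fun hb => hab (by rw [hb]))
      have := hnorm e
      rw [he, Units.val_mk0] at this
      rw [this]
      split_ifs <;> simp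
    · exact Or.inl (hnorm₁ a b ha)
  have hpair : ∀ e : ℕ, ((0 : E), ((ω ^ e : Lˣ) : L)) ≠ (0, 0) := fun e h0 =>
    (Units.ne_zero (ω ^ e)) (congrArg Prod.snd h0)
  have hnz : ∀ (a : E) (b : L), (a, b) ≠ (0, 0) → hammingNorm (codewordK F K a b) ≠ 0 := by
    intro a b hab
    rcases hcases a b hab with h' | h' | h' <;> rw [h'] <;> omega
  have hcount := weightCount_codeK hω hnz hh0 (by rwa [hcard]) hnorm₁ hnorm
  rw [hcard, hcardE] at hcount
  have hnodup : [0, w₁, w₂, w₃].Nodup := by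
    simp only [List.nodup_cons, List.mem_cons, List.not_mem_nil, or_false, not_or]
    refine ⟨⟨?_, ?_, ?_⟩, ⟨?_, ?_⟩, ?_, ?_⟩ <;> first | omega | simp
  have hnodup' := hnodup
  simp only [List.nodup_cons, List.mem_cons, List.not_mem_nil, or_false, not_or] at hnodup'
  obtain ⟨⟨h01, h02, h03⟩, ⟨h12, h13⟩, h23, -⟩ := hnodup'
  have hc₁ : weightCount (codeK F K) w₁ = (q ^ m₁ - 1) * q ^ m := by
    simp [hcount, h01, Ne.symm h12, Ne.symm h13]
  have hc₂ : weightCount (codeK F K) w₂ = (q ^ m - 1) / h := by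
    simp [hcount, h02, h12, Ne.symm h23]
  have hc₃ : weightCount (codeK F K) w₃ = (q ^ m - 1) - (q ^ m - 1) / h := by
    simp [hcount, h03, h13, h23]
  have hother : ∀ i : ℕ, i ∉ [0, w₁, w₂, w₃] → weightCount (codeK F K) i = 0 := by
    intro i hi
    simp only [List.mem_cons, List.not_mem_nil, or_false, not_or] at hi
    simp [hcount, Ne.symm hi.1, Ne.symm hi.2.1, Ne.symm hi.2.2.1, Ne.symm hi.2.2.2]
  have hqm₁ : 1 < q ^ m₁ := Nat.one_lt_pow hm₁0.ne' hq1
  have hdivpos : 0 < (q ^ m - 1) / h :=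
    Nat.div_pos (Nat.le_of_dvd (by omega) hdvd) hh0
  have hdivlt : (q ^ m - 1) / h < q ^ m - 1 := Nat.div_lt_self (by omega) (by omega)
  have hrcast : ((q ^ m - 1 : ℕ) : ℝ) = (q : ℝ) ^ m - 1 := by
    rw [Nat.cast_sub hr1.le]
    push_cast
    rfl
  have hdivcast : (((q ^ m - 1) / h : ℕ) : ℝ) = ((q : ℝ) ^ m - 1) / h := by
    rw [Nat.cast_div hdvd (by positivity), hrcast]
  -- The parity of γ decides which of w₂ and w₃ is smaller; w₁ always lies strictly between them.
  refine ⟨if Even γ then w₃ else w₂, w₁, w₂, w₃, ?_, hw₁', hw₂', hw₃', hnodup, ?_, ?_, ?_, ?_, ?_,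
    ?_, hother⟩
  · split_ifs with hγ
    · rw [hw₃', hγ.add_one.neg_one_pow]; ring
    · rw [hw₂', (Nat.not_even_iff_odd.1 hγ).neg_one_pow]; ring
  · rw [← hm, ← hm₁]
    refine isLinearCodeWithParams_codeK hnz ?_ ?_ ?_
    · rw [Fintype.card_sum, card_definingSetK hω (by rwa [hcard]) hh0, hcardE, hm₁]
      ring
    · split_ifs
      · exact ⟨0, _, hpair (e₀ + 1), by rw [hnorm, if_neg hne]⟩
      · exact ⟨0, _, hpair e₀, by rw [hnorm, sub_self, if_pos (dvd_zero _)]⟩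
    · intro a b hab
      rcases horder with ⟨hγ, -, ho₁, ho₂⟩ | ⟨hγ, -, ho₁, ho₂⟩ <;>
      simp only [hγ, ↓reduceIte] <;>
      rcases hcases a b hab with h' | h' | h' <;> omega
  · refine isWeightCode_three hnodup ?_ ?_ ?_ hother
    · rw [hc₁]
      exact (Nat.mul_pos (by omega) (by omega)).ne'
    · omega
    · omega
  · simp [hcount, Ne.symm h01, Ne.symm h02, Ne.symm h03]
  · rw [hc₁]
    push_cast [Nat.cast_sub hqm₁.le]
    ring
  · rw [hc₂, hdivcast]
  · rw [hc₃, Nat.cast_sub hdivlt.le, hdivcast, hrcast]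
    field_simp
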